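/- All rings are commutative with identity. For $n \ge 0$, an $R$-module $E$ is called $n$-presented if there is an exact sequence $F_n \to F_{n-1} \to \dots \to F_0 \to E \to 0$ with every $F_i$ a finitely generated free $R$-module. For $n, d \ge 0$, a ring $R$ is called an $(n,d)$-ring if $\mathrm{pd}_R(E) \le d$ for every $n$-presented $R$-module $E$. Let $A$ be a local (not necessarily Noetherian) ring with maximal ideal $M$, let $f : A \to B$ be a ring homomorphism, and let $J$ be a nonzero proper ideal of $B$ such that $f(M)J = 0$ and $J^2 = 0$. Let $$A \bowtie^f J = \{(a, f(a)+j) \mid a \in A,\ j \in J\} \subseteq A \times B$$ be the amalgamation of $A$ with $B$ along $J$ with respect to $f$. 1. If $M$ is not a finitely generated ideal of $A$, then $A \bowtie^f J$ is a $(3,0)$-ring. 2. Assume that $J$ is finitely generated as an ideal of the subring $f(A)+J$ of $B$, and that $M$ contains a regular element (a non-zero-divisor of $A$). Then: (a) $A \bowtie^f J$ is not a $(2,d)$-ring for any integer $d \ge 0$. (b) If moreover $M$ is not finitely generated and $A_2$ is a Noetherian ring of finite global dimension $d$, then $(A \bowtie^f J) \times A_2$ is a $(3,d)$-ring which is not a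 $(2,d)$-ring and, if $d \ge 1$, not a $(3,d-1)$-ring. -/

import Mathlib

universe u v

/-- The amalgamation `A ⋈^f J = {(a, f a + j) | a ∈ A, j ∈ J}`, as a subring of `A × B`. -/
def amalgamation {A : Type u} {B : Type v} [CommRing A] [CommRing B] (f : A →+* B) (J : Ideal B) :
    Subring (A × B) where
  carrier := {x | ∃ a : A, ∃ j ∈ J, x = (a, f a + j)}
  mul_mem' := by
    rintro _ _ ⟨a, i, hi, rfl⟩ ⟨b, j, hj, rfl⟩
    refine ⟨a * b, f a * j + i * f b + i * j,
      J.add_mem (J.add_mem (J.mul_mem_left _ hj) (J.mul_mem_right _ hi)) (J.mul_mem_left _ hj), ?_⟩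
    rw [Prod.mk_mul_mk, map_mul]
    congr 1
    ring
  one_mem' := ⟨1, 0, J.zero_mem, by rw [map_one, add_zero]; rfl⟩
  add_mem' := by
    rintro _ _ ⟨a, i, hi, rfl⟩ ⟨b, j, hj, rfl⟩
    refine ⟨a + b, i + j, J.add_mem hi hj, ?_⟩
    rw [Prod.mk_add_mk, map_add]
    congr 1
    ring
  zero_mem' := ⟨0, 0, J.zero_mem, by rw [map_zero, add_zero]; rfl⟩
  neg_mem' := by
    rintro _ ⟨a, i, hi, rfl⟩
    refine ⟨-a, -i, J.neg_mem hi, ?_⟩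
    rw [Prod.neg_mk, map_neg]
    congr 1
    ring

/-- The subring `f(A) + J = {f a + j | a ∈ A, j ∈ J}` of `B`. -/
def rangeAddIdeal {A : Type u} {B : Type v} [CommRing A] [CommRing B] (f : A →+* B)
    (J : Ideal B) : Subring B where
  carrier := {b | ∃ a : A, ∃ j ∈ J, b = f a + j}
  mul_mem' := by
    rintro _ _ ⟨a, i, hi, rfl⟩ ⟨b, j, hj, rfl⟩
    refine ⟨a * b, f a * j + i * f b + i * j,
      J.add_mem (J.add_mem (J.mul_mem_left _ hj) (J.mul_mem_right _ hi)) (J.mul_mem_left _ hj), ?_⟩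
    rw [map_mul]
    ring
  one_mem' := ⟨1, 0, J.zero_mem, by simp⟩
  add_mem' := by
    rintro _ _ ⟨a, i, hi, rfl⟩ ⟨b, j, hj, rfl⟩
    refine ⟨a + b, i + j, J.add_mem hi hj, ?_⟩
    rw [map_add]
    ring
  zero_mem' := ⟨0, 0, J.zero_mem, by simp⟩
  neg_mem' := by
    rintro _ ⟨a, i, hi, rfl⟩
    refine ⟨-a, -i, J.neg_mem hi, ?_⟩
    rw [map_neg]
    ring

/-- `J`, which is contained in `f(A) + J`, regarded as an ideal of the ring `f(A) + J`. -/
def idealOfRangeAdd {A : Type u} {B : Type v} [CommRing A] [CommRing B] (f : A →+* B)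
    (J : Ideal B) : Ideal (rangeAddIdeal f J) :=
  J.comap (rangeAddIdeal f J).subtype

/-- `E` is `n`-presented over `R`: there is an exact sequence
`F_n → ⋯ → F_1 → F_0 → E → 0` with `F_i = R ^ (r i)`. The data `r i` for `i > n` and
`δ i : F_(i+1) → F_i` for `i ≥ n` are unconstrained and play no role. -/
def IsNPresented (R : Type u) [CommRing R] (n : ℕ) (E : Type v) [AddCommGroup E] [Module R E] :
    Prop :=
  ∃ (r : ℕ → ℕ) (ε : (Fin (r 0) → R) →ₗ[R] E)
    (δ : ∀ i : ℕ, (Fin (r (i + 1)) → R) →ₗ[R] (Fin (r i) → R)),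
    Function.Surjective ε ∧ (1 ≤ n → Function.Exact (δ 0) ε) ∧
      ∀ i : ℕ, i + 2 ≤ n → Function.Exact (δ (i + 1)) (δ i)

/-- `R` is an `(n, d)`-ring: every `n`-presented `R`-module has projective dimension at most `d`.
(An `n`-presented module is finitely generated, hence isomorphic to one in the universe of `R`.) -/
def IsNDRing (R : Type u) [CommRing R] (n d : ℕ) : Prop :=
  ∀ (E : Type u) [AddCommGroup E] [Module R E], IsNPresented R n E →
    CategoryTheory.projectiveDimension (ModuleCat.of R E) ≤ (d : WithBot ℕ∞)

/-- `R` has (finite) global dimension `d`: the number `d` is the least upper bound of the projective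
dimensions of all `R`-modules, finitely generated or not. -/
def HasGlobalDimension (R : Type u) [CommRing R] (d : ℕ) : Prop :=
  IsLeast {n : ℕ | ∀ (E : Type u) [AddCommGroup E] [Module R E],
    CategoryTheory.projectiveDimension (ModuleCat.of R E) ≤ (n : WithBot ℕ∞)} d

/-! ### Syzygies and `n`-presented modules. -/

section IsNPresented

variable {R : Type u} [CommRing R]

/-! Put `R = A ⋈^f J`, a local ring with maximal ideal `𝔪 = M ⋈^f J` and residue field `k`. For `0 ≠
j ∈ J` the element `x = (0, j)` lies in `𝔪`, is killed by `𝔪`, and is outside `𝔪 ^ 2`, whose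
elements all have the form `(a, f a)`. So `1 ↦ x` embeds `k` in `𝔪`, and a functional on `𝔪 / 𝔪 ^ 2`
splits it: `k` is a summand of every ideal between `(x)` and `𝔪`.

For a `3`-presented `E`, take two minimal covers. If the first syzygy is nonzero, the second one is
finitely presented and has `k` as a summand, so `𝔪` is finitely generated, and hence so is `M`.
Otherwise `E` is free (`IsNPresented.projective_of_isLocalRing`).

Since `k` is a nonprojective summand of its own syzygy `𝔪`, it has infinite projective dimension.
For `m ∈ M` regular and `s = (m, f m)`, the annihilator of `s` is `0 × J`, which contains `x` and is
finitely generated; so `R / (s)` is `2`-presented and has `k` as a summand of its second syzygy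
(`not_isNDRing_two`).

Over `R × A₂` modules split into components, which gives the upper bound. The lower bound is
Auslander's theorem: cyclic modules detect the global dimension, and over a Noetherian factor they
are `n`-presented for all `n`. -/

theorem isNPresented_zero_iff {E : Type*} [AddCommGroup E] [Module R E] :
    IsNPresented R 0 E ↔ Module.Finite R E := by
  constructor
  · rintro ⟨r, ε, δ, hε, -⟩
    exact Module.Finite.of_surjective ε hε
  · intro h
    obtain ⟨n, ε, hε⟩ := Module.Finite.exists_fin' R E
    exact ⟨fun _ => n, ε, fun _ => 0, hε, by omega, by omega⟩

theorem IsNPresented.finite {n : ℕ} {E : Type*} [AddCommGroup E] [Module R E]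
    (h : IsNPresented R n E) : Module.Finite R E := by
  obtain ⟨r, ε, δ, hε, -⟩ := h
  exact Module.Finite.of_surjective ε hε

theorem IsNPresented.of_equiv {n : ℕ} {E E' : Type*} [AddCommGroup E] [Module R E]
    [AddCommGroup E'] [Module R E'] (h : IsNPresented R n E) (e : E ≃ₗ[R] E') :
    IsNPresented R n E' := by
  obtain ⟨r, ε, δ, hε, h0, h1⟩ := h
  refine ⟨r, e ∘ₗ ε, δ, e.surjective.comp hε, fun hn y => ?_, h1⟩
  rw [← h0 hn y]
  simp

theorem isNPresented_succ_iff {n : ℕ} {E : Type*} [AddCommGroup E] [Module R E] :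
    IsNPresented R (n + 1) E ↔ ∃ (m : ℕ) (ε : (Fin m → R) →ₗ[R] E), Function.Surjective ε ∧
      IsNPresented R n (LinearMap.ker ε) := by
  constructor
  · rintro ⟨r, ε, δ, hε, h0, h1⟩
    have hex := h0 (by omega)
    refine ⟨r 0, ε, hε, fun i => r (i + 1),
      (δ 0).codRestrict _ fun x => (hex _).2 ⟨x, rfl⟩, fun i => δ (i + 1), ?_, ?_, ?_⟩
    · rintro ⟨y, hy⟩
      obtain ⟨x, hx⟩ := (hex y).1 hy
      exact ⟨x, Subtype.ext hx⟩
    · intro hn y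
      rw [← h1 0 (by omega) y, Subtype.ext_iff]
      rfl
    · intro i hi
      exact h1 (i + 1) (by omega)
  · rintro ⟨m, ε, hε, r, ε', δ, hε', h0, h1⟩
    refine ⟨fun i => Nat.casesOn i m r, ε,
      fun i => Nat.casesOn i ((LinearMap.ker ε).subtype ∘ₗ ε') δ, hε, ?_, ?_⟩
    · intro _ y
      constructor
      · intro hy
        obtain ⟨x, hx⟩ := hε' ⟨y, hy⟩
        exact ⟨x, congrArg Subtype.val hx⟩
      · rintro ⟨x, rfl⟩
        exact (ε' x).2
    · rintro (_ | i) hi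
      · intro y
        rw [← h0 (by omega) y]
        exact Submodule.coe_eq_zero
      · exact h1 i (by omega)

theorem IsNPresented.succ_of_surjective {n m : ℕ} {E F : Type*} [AddCommGroup E] [Module R E]
    [AddCommGroup F] [Module R F] (e : (Fin m → R) ≃ₗ[R] F) (f : F →ₗ[R] E)
    (hf : Function.Surjective f) (h : IsNPresented R n (LinearMap.ker f)) :
    IsNPresented R (n + 1) E := by
  refine isNPresented_succ_iff.2 ⟨m, f ∘ₗ e, hf.comp e.surjective, h.of_equiv ?_⟩
  rw [LinearMap.ker_comp]
  exact (e.ofSubmodule' (LinearMap.ker f)).symm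

theorem Function.Exact.conj_prodMap {M₁ M₂ M₃ N₁ N₂ N₃ : Type*} [AddCommGroup M₁] [AddCommGroup M₂]
    [AddCommGroup M₃] [AddCommGroup N₁] [AddCommGroup N₂] [AddCommGroup N₃] [Module R M₁]
    [Module R M₂] [Module R M₃] [Module R N₁] [Module R N₂] [Module R N₃]
    {P₁ P₂ : Type*} [AddCommGroup P₁] [AddCommGroup P₂] [Module R P₁] [Module R P₂]
    {f : M₁ →ₗ[R] M₂} {g : M₂ →ₗ[R] M₃} {f' : N₁ →ₗ[R] N₂} {g' : N₂ →ₗ[R] N₃}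
    (h : Function.Exact f g) (h' : Function.Exact f' g')
    (e₁ : P₁ ≃ₗ[R] M₁ × N₁) (e₂ : P₂ ≃ₗ[R] M₂ × N₂) :
    Function.Exact (e₂.symm ∘ₗ f.prodMap f' ∘ₗ e₁ : P₁ →ₗ[R] P₂) (g.prodMap g' ∘ₗ e₂) := by
  intro y
  simp only [LinearMap.comp_apply, LinearEquiv.coe_coe, LinearMap.prodMap_apply, Prod.mk_eq_zero,
    h _, h' _, Set.mem_range]
  constructor
  · rintro ⟨⟨a, ha⟩, b, hb⟩
    exact ⟨e₁.symm (a, b), by simp [ha, hb]⟩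
  · rintro ⟨x, rfl⟩
    exact ⟨⟨_, by simp; rfl⟩, ⟨_, by simp; rfl⟩⟩

/-- `R ^ (a + b) = R ^ a × R ^ b`. -/
def finAddFunEquiv (R : Type u) [CommRing R] (a b : ℕ) :
    (Fin (a + b) → R) ≃ₗ[R] (Fin a → R) × (Fin b → R) :=
  (LinearEquiv.funCongrLeft R R finSumFinEquiv).trans (LinearEquiv.sumArrowLequivProdArrow _ _ R R)

theorem IsNPresented.prod {n : ℕ} {E E' : Type*} [AddCommGroup E] [Module R E]
    [AddCommGroup E'] [Module R E'] (h : IsNPresented R n E) (h' : IsNPresented R n E') :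
    IsNPresented R n (E × E') := by
  obtain ⟨r, ε, δ, hε, h0, h1⟩ := h
  obtain ⟨r', ε', δ', hε', h0', h1'⟩ := h'
  refine ⟨fun i => r i + r' i, ε.prodMap ε' ∘ₗ finAddFunEquiv R (r 0) (r' 0),
    fun i => (finAddFunEquiv R (r i) (r' i)).symm ∘ₗ (δ i).prodMap (δ' i) ∘ₗ finAddFunEquiv R (r (i + 1)) (r' (i + 1)),
    (hε.prodMap hε').comp (LinearEquiv.surjective _), fun hn => ?_, fun i hi => ?_⟩
  · exact (h0 hn).conj_prodMap (h0' hn) _ _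
  · have := (h1 i hi).conj_prodMap (h1' i hi) (finAddFunEquiv R _ _) (finAddFunEquiv R _ _)
    intro y
    rw [← this y]
    simp

/-- If `P` is the image of an idempotent `e` of `R ^ m`, it has a periodic resolution by `R ^ m` in
which `1 - e` and `e` alternate. -/
theorem isNPresented_of_projective (n : ℕ) (P : Type*) [AddCommGroup P] [Module R P]
    [Module.Finite R P] [Module.Projective R P] : IsNPresented R n P := by
  obtain ⟨m, f, g, hf, -, hfg⟩ := Module.Finite.exists_comp_eq_id_of_projective R P
  have hfg' : ∀ x, f (g x) = x := fun x => LinearMap.congr_fun hfg x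
  obtain ⟨q, hq⟩ : ∃ q : (Fin m → R) →ₗ[R] (Fin m → R), ∀ x, q x = x - g (f x) :=
    ⟨LinearMap.id - g ∘ₗ f, fun _ => rfl⟩
  have hex : Function.Exact q (g ∘ₗ f) := fun y => by
    constructor
    · intro hy
      have hy' : g (f y) = 0 := hy
      exact ⟨y, by simp [hq, hy']⟩
    · rintro ⟨x, rfl⟩
      simp [hq, hfg']
  have hex' : Function.Exact (g ∘ₗ f) q := fun y => by
    constructor
    · intro hy
      rw [hq] at hy
      exact ⟨y, (sub_eq_zero.1 hy).symm⟩
    · rintro ⟨x, rfl⟩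
      simp [hq, hfg']
  refine ⟨fun _ => m, f, fun i => if Even i then q else g ∘ₗ f, hf, fun _ y => ?_, fun i _ => ?_⟩
  · simp only [Even.zero, if_true]
    rw [← hex y]
    refine ⟨fun h => by simp [h], fun h => ?_⟩
    rw [← hfg' (f y)]
    exact (congrArg f h).trans (map_zero f)
  · by_cases hi : Even i
    · simpa [hi, Nat.even_add_one] using hex'
    · simpa [hi, Nat.even_add_one] using hex

/-- If `E = P / K` with `P` projective and finitely generated, then `E` is `(n + 1)`-presented
when `K` is `n`-presented. -/
theorem IsNPresented.succ_of_projective {n : ℕ} {E P : Type*} [AddCommGroup E] [Module R E]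
    [AddCommGroup P] [Module R P] [Module.Finite R P] [Module.Projective R P] (p : P →ₗ[R] E)
    (hp : Function.Surjective p) (h : IsNPresented R n (LinearMap.ker p)) :
    IsNPresented R (n + 1) E := by
  obtain ⟨m, f, g, hf, -, hfg⟩ := Module.Finite.exists_comp_eq_id_of_projective R P
  have hfg' : ∀ x, f (g x) = x := fun x => LinearMap.congr_fun hfg x
  have hker : LinearMap.ker f = LinearMap.range (LinearMap.id - g ∘ₗ f) :=
    LinearMap.ker_eq_range_of_comp_eq_id hfg
  let ρ : (Fin m → R) →ₗ[R] LinearMap.ker f :=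
    (LinearMap.id - g ∘ₗ f).codRestrict _ fun x => by simp [hfg']
  have hρ : ρ ∘ₗ (LinearMap.ker f).subtype = LinearMap.id := by
    ext x : 2
    simp [ρ]
  have : Module.Projective R (LinearMap.ker f) := Module.Projective.of_split _ ρ hρ
  have : Module.Finite R (LinearMap.ker f) := Module.Finite.of_surjective ρ fun x =>
    ⟨x, LinearMap.congr_fun hρ x⟩
  refine isNPresented_succ_iff.2 ⟨m, p ∘ₗ f, hp.comp hf,
    (h.prod (isNPresented_of_projective n (LinearMap.ker f))).of_equiv ?_⟩
  -- The section `g` of `f` splits the kernel of `p ∘ f` as `ker p × ker f`, and the second factor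
  -- is projective.
  refine LinearEquiv.ofLinearMap
    (((g ∘ₗ (LinearMap.ker p).subtype).coprod (LinearMap.ker f).subtype).codRestrict _ ?_)
    (LinearMap.prod ((f ∘ₗ (LinearMap.ker (p ∘ₗ f)).subtype).codRestrict _ ?_)
      (ρ ∘ₗ (LinearMap.ker (p ∘ₗ f)).subtype)) ?_ ?_
  · rintro ⟨⟨x, hx⟩, ⟨y, hy⟩⟩
    have hy' : f y = 0 := hy
    have hx' : p x = 0 := hx
    simp [hfg', hx', hy']
  · rintro ⟨x, hx⟩
    exact hx
  · ext x : 2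
    simp [ρ]
  · apply LinearMap.ext
    rintro ⟨⟨x, hx⟩, ⟨y, hy⟩⟩
    have hy' : f y = 0 := hy
    ext <;> simp [ρ, hfg', hy']

/-- A cover of `E × R ^ m` also covers `E`; lifting `R ^ m` along it shows that the new kernel is
the old one times `R ^ m`. -/
theorem IsNPresented.of_prod_fin {n m : ℕ} {E : Type*} [AddCommGroup E] [Module R E]
    (h : IsNPresented R n (E × (Fin m → R))) : IsNPresented R n E := by
  cases n with
  | zero =>
    have := h.finite
    exact isNPresented_zero_iff.2 (Module.Finite.of_surjective (LinearMap.fst R E (Fin m → R))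
      LinearMap.fst_surjective)
  | succ n =>
    obtain ⟨k, ε, hε, hK⟩ := isNPresented_succ_iff.1 h
    obtain ⟨σ, hσ⟩ := Module.projective_lifting_property ε (LinearMap.inr R E (Fin m → R)) hε
    have hσ' : ∀ x, ε (σ x) = (0, x) := fun x => LinearMap.congr_fun hσ x
    refine isNPresented_succ_iff.2 ⟨k, LinearMap.fst R E _ ∘ₗ ε,
      (LinearMap.fst_surjective (R := R)).comp hε,
      (hK.prod (isNPresented_of_projective n (Fin m → R))).of_equiv ?_⟩
    let τ : (Fin k → R) →ₗ[R] (Fin m → R) := LinearMap.snd R E _ ∘ₗ ε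
    let K := LinearMap.ker (LinearMap.fst R E (Fin m → R) ∘ₗ ε)
    let φ : LinearMap.ker ε × (Fin m → R) →ₗ[R] K :=
      ((LinearMap.ker ε).subtype.coprod σ).codRestrict K <| by
        rintro ⟨⟨x, hx⟩, y⟩
        have hx' : ε x = 0 := hx
        simp [K, hσ', hx']
    let ψ : K →ₗ[R] LinearMap.ker ε :=
      ((LinearMap.id - σ ∘ₗ τ) ∘ₗ K.subtype).codRestrict _ <| by
        rintro ⟨x, hx⟩
        have hx' : (ε x).1 = 0 := hx
        refine Prod.ext ?_ ?_ <;> simp [hσ', hx', τ]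
    refine LinearEquiv.ofLinearMap φ (ψ.prod (τ ∘ₗ K.subtype)) ?_ ?_
    · ext x : 2
      simp [φ, ψ]
    · apply LinearMap.ext
      rintro ⟨⟨x, hx⟩, y⟩
      have hx' : ε x = 0 := hx
      refine Prod.ext (Subtype.ext ?_) ?_ <;> simp [φ, ψ, τ, hσ', hx']

/-- A consequence of Schanuel's lemma: the kernel of any map from a finitely generated free module
onto an `(n + 1)`-presented module is `n`-presented. -/
theorem IsNPresented.ker {n m : ℕ} {E : Type*} [AddCommGroup E] [Module R E]
    (h : IsNPresented R (n + 1) E) (ε : (Fin m → R) →ₗ[R] E) (hε : Function.Surjective ε) :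
    IsNPresented R n (LinearMap.ker ε) := by
  obtain ⟨k, ε', hε', hK⟩ := isNPresented_succ_iff.1 h
  obtain ⟨g, hg⟩ := Module.projective_lifting_property ε ε' hε
  obtain ⟨g', hg'⟩ := Module.projective_lifting_property ε' ε hε'
  replace hg : ∀ x, ε (g x) = ε' x := fun x => LinearMap.congr_fun hg x
  replace hg' : ∀ x, ε' (g' x) = ε x := fun x => LinearMap.congr_fun hg' x
  -- Both `ker ε' × R ^ m` and `ker ε × R ^ k` are the pullback of `ε` and `ε'`; the free factor `R
  -- ^ k` is then cancelled.
  refine ((hK.prod (isNPresented_of_projective n (Fin m → R))).of_equiv ?_).of_prod_fin (m := k)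
  let u : LinearMap.ker ε' × (Fin m → R) →ₗ[R] (Fin k → R) :=
    (LinearMap.ker ε').subtype.coprod g'
  let u' : LinearMap.ker ε × (Fin k → R) →ₗ[R] (Fin m → R) :=
    (LinearMap.ker ε).subtype.coprod g
  let φ : LinearMap.ker ε' × (Fin m → R) →ₗ[R] LinearMap.ker ε :=
    (LinearMap.snd R _ _ - g ∘ₗ u).codRestrict _ <| by
      rintro ⟨⟨x, hx⟩, y⟩
      have hx' : ε' x = 0 := hx
      simp [u, hg, hg', hx']
  let ψ : LinearMap.ker ε × (Fin k → R) →ₗ[R] LinearMap.ker ε' :=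
    (LinearMap.snd R _ _ - g' ∘ₗ u').codRestrict _ <| by
      rintro ⟨⟨x, hx⟩, y⟩
      have hx' : ε x = 0 := hx
      simp [u', hg, hg', hx']
  refine LinearEquiv.ofLinearMap (φ.prod u) (ψ.prod u') ?_ ?_
  · apply LinearMap.ext
    rintro ⟨⟨x, hx⟩, y⟩
    refine Prod.ext (Subtype.ext ?_) ?_ <;> simp [φ, ψ, u, u']
  · apply LinearMap.ext
    rintro ⟨⟨x, hx⟩, y⟩
    refine Prod.ext (Subtype.ext ?_) ?_ <;> simp [φ, ψ, u, u']

theorem IsNPresented.finitePresentation {E : Type*} [AddCommGroup E] [Module R E]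
    (h : IsNPresented R 1 E) : Module.FinitePresentation R E := by
  obtain ⟨m, ε, hε, hK⟩ := isNPresented_succ_iff.1 h
  exact Module.finitePresentation_of_surjective ε hε (Module.Finite.iff_fg.1 hK.finite)

end IsNPresented

/-! ### Auslander's theorem on global dimension. -/

open CategoryTheory Abelian in
/-- **Auslander's theorem**: the projective dimensions of the cyclic modules bound those of all
modules. -/
theorem hasProjectiveDimensionLE_of_forall_quotient {R : Type u} [CommRing R] (n : ℕ)
    (h : ∀ I : Ideal R, HasProjectiveDimensionLE (ModuleCat.of R (R ⧸ I)) n)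
    (E : ModuleCat.{u} R) : HasProjectiveDimensionLE E n := by
  suffices H : ∀ (k : ℕ) (N : ModuleCat.{u} R),
      (∀ I : Ideal R, Subsingleton (Ext (ModuleCat.of R (R ⧸ I)) N (k + 1))) →
        ∀ X : ModuleCat.{u} R, Subsingleton (Ext X N (k + 1)) by
    refine hasProjectiveDimensionLT_of_enoughInjectives E _ fun N => H n N (fun I => ?_) E
    have := h I
    exact HasProjectiveDimensionLT.subsingleton _ (n + 1) (n + 1) le_rfl N
  intro k
  induction k with
  | zero =>
    intro N hN X
    -- `Ext¹(R / I, N)` is the obstruction to extending a map `I → N` to `R`, so Baer's criterion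
    -- makes `N` injective.
    have hB : Module.Baer R N := by
      intro I g
      have hs := LinearMap.shortExact_shortComplexKer (f := I.mkQ) I.mkQ_surjective
      have hker : ∀ x, x ∈ LinearMap.ker I.mkQ → x ∈ I := fun x hx => by simpa using hx
      let e : LinearMap.ker I.mkQ →ₗ[R] N := g ∘ₗ Submodule.inclusion hker
      have := hN I
      obtain ⟨φ, hφ⟩ := Ext.contravariant_sequence_exact₁ hs N (Ext.mk₀ (ModuleCat.ofHom e))
        (zero_add 1) (Subsingleton.elim (h := hN I) _ _)
      obtain ⟨φ, rfl⟩ := Ext.homEquiv₀.symm.surjective φ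
      have hφ' : I.mkQ.shortComplexKer.f ≫ φ = ModuleCat.ofHom e :=
        Ext.homEquiv₀.symm.injective (by simpa using hφ)
      refine ⟨φ.hom, fun x hx => ?_⟩
      exact congrArg (fun q => q.hom ⟨x, by simpa using hx⟩) hφ'
    have : Injective N := (Module.injective_iff_injective_object R N).1 hB.injective
    exact Ext.subsingleton_of_injective _ _ _
  | succ k ih =>
    intro N hN X
    -- Dimension shift: embed `N` in an injective and pass to the cokernel.
    let hs : (ShortComplex.mk _ _ (Limits.cokernel.condition (Injective.ι N))).ShortExact :=
      { exact := ShortComplex.exact_cokernel (Injective.ι N) }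
    have hC := ih (Limits.cokernel (Injective.ι N)) fun I => by
      refine subsingleton_of_forall_eq 0 fun x => ?_
      obtain ⟨y, rfl⟩ := Ext.covariant_sequence_exact₃ _ hs x rfl
        (Subsingleton.elim (h := hN I) _ _)
      rw [Ext.eq_zero_of_injective y, Ext.zero_comp]
    refine subsingleton_of_forall_eq 0 fun x => ?_
    obtain ⟨y, rfl⟩ := Ext.covariant_sequence_exact₁ _ hs x (Ext.eq_zero_of_injective _) rfl
    rw [Subsingleton.elim (h := hC X) y 0, Ext.zero_comp]

/-! ### Projective dimension along a surjection `S → T` with `T` projective over `S`. -/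

section ChangeOfRings

open CategoryTheory

variable {S : Type u} {T : Type v} [CommRing S] [CommRing T] [Algebra S T]

theorem projective_finsupp {R : Type*} [CommRing R] (ι P : Type*) [AddCommGroup P] [Module R P]
    [Module.Projective R P] : Module.Projective R (ι →₀ P) := by
  classical
  exact Module.Projective.of_equiv (finsuppLEquivDirectSum R P ι).symm

/-- The cover `E →₀ T` is projective over both rings, and by surjectivity an `S`-linear section of
it is already `T`-linear. -/
theorem projective_iff_of_algebraMap_surjective (hS : Function.Surjective (algebraMap S T))
    [Module.Projective S T] (E : Type*) [AddCommGroup E] [Module S E] [Module T E]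
    [IsScalarTower S T E] : Module.Projective T E ↔ Module.Projective S E := by
  let p := Finsupp.linearCombination T (id : E → E)
  have hp : Function.Surjective p := Finsupp.linearCombination_id_surjective T E
  constructor
  · intro h
    have := projective_finsupp (R := S) E T
    obtain ⟨s, hs⟩ := Module.projective_lifting_property p LinearMap.id hp
    exact Module.Projective.of_split (s.restrictScalars S) (p.restrictScalars S)
      (LinearMap.ext fun x => LinearMap.congr_fun hs x)
  · intro h
    obtain ⟨s, hs⟩ := Module.projective_lifting_property (p.restrictScalars S) LinearMap.id hp
    exact Module.Projective.of_split (s.extendScalarsOfSurjective hS) p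
      (LinearMap.ext fun x => LinearMap.congr_fun hs x)

theorem hasProjectiveDimensionLE_zero_iff {R : Type u} [CommRing R] (E : Type v) [AddCommGroup E]
    [Module R E] [Small.{v} R] :
    HasProjectiveDimensionLE (ModuleCat.of R E) 0 ↔ Module.Projective R E := by
  rw [IsProjective.iff_projective, projective_iff_hasProjectiveDimensionLE_zero]

/-- For a surjective ring homomorphism `S → T` with `T` projective over `S`, the projective
dimension of a `T`-module is the same over `T` and over `S`. -/
theorem hasProjectiveDimensionLE_iff_of_algebraMap_surjective
    (hS : Function.Surjective (algebraMap S T)) [Module.Projective S T] (n : ℕ)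
    (E : Type (max u v)) [AddCommGroup E] [Module S E] [Module T E] [IsScalarTower S T E] :
    HasProjectiveDimensionLE (ModuleCat.of T E) n ↔
      HasProjectiveDimensionLE (ModuleCat.of S E) n := by
  induction n generalizing E with
  | zero =>
    rw [hasProjectiveDimensionLE_zero_iff, hasProjectiveDimensionLE_zero_iff]
    exact projective_iff_of_algebraMap_surjective hS E
  | succ n ih =>
    let p : (E →₀ T) →ₗ[T] E := Finsupp.linearCombination T id
    have hp : Function.Surjective p := Finsupp.linearCombination_id_surjective T E
    have hT := LinearMap.shortExact_shortComplexKer hp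
    have hS := LinearMap.shortExact_shortComplexKer (f := p.restrictScalars S) hp
    have := projective_finsupp (R := S) E T
    exact (hT.hasProjectiveDimensionLT_X₃_iff n
      ((IsProjective.iff_projective (E →₀ T)).1 inferInstance)).trans <|
        (ih (LinearMap.ker p)).trans (hS.hasProjectiveDimensionLT_X₃_iff n
          ((IsProjective.iff_projective (E →₀ T)).1 inferInstance)).symm

end ChangeOfRings

/-! ### Rings with an element outside `𝔪 ^ 2` killed by `𝔪`. -/

/-- A minimal system of generators of a finitely generated module over a local ring. -/
theorem exists_surjective_ker_le_maximalIdeal {R : Type*} [CommRing R] [IsLocalRing R]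
    (E : Type*) [AddCommGroup E] [Module R E] [Module.Finite R E] :
    ∃ (n : ℕ) (ε : (Fin n → R) →ₗ[R] E), Function.Surjective ε ∧
      ∀ v, ε v = 0 → ∀ i, v i ∈ IsLocalRing.maximalIdeal R := by
  let k := IsLocalRing.ResidueField R
  let b := Module.finBasis k (TensorProduct R k E)
  have hsurj := TensorProduct.mk_surjective R E k Ideal.Quotient.mk_surjective
  choose w hw using fun i => hsurj (b i)
  refine ⟨_, Fintype.linearCombination R w, ?_, fun v hv i => ?_⟩
  · rw [← LinearMap.range_eq_top, Fintype.range_linearCombination]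
    exact IsLocalRing.span_eq_top_of_tmul_eq_basis w b hw
  · have h0 : ∑ j, IsLocalRing.residue R (v j) • b j = 0 := by
      have := congrArg (TensorProduct.mk R k E 1) hv
      rw [Fintype.linearCombination_apply, map_sum, map_zero] at this
      rw [← this]
      refine Finset.sum_congr rfl fun j _ => ?_
      rw [map_smul, hw]
      exact algebraMap_smul k (v j) (b j)
    have := Fintype.linearIndependent_iff.1 b.linearIndependent _ h0 i
    rwa [IsLocalRing.residue_eq_zero_iff] at this

/-- An element of `𝔪` outside `𝔪 ^ 2` is sent to `1` by a functional `𝔪 → R / 𝔪`. -/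
theorem exists_linearMap_quotient_eq_one {R : Type*} [CommRing R] {𝔪 : Ideal R} [𝔪.IsMaximal]
    (x : 𝔪) (hx : (x : R) ∉ 𝔪 ^ 2) : ∃ ψ : 𝔪 →ₗ[R] R ⧸ 𝔪, ψ x = 1 := by
  let _ := Ideal.Quotient.field 𝔪
  have hx' : 𝔪.toCotangent x ≠ 0 := fun h => hx ((𝔪.toCotangent_eq_zero x).1 h)
  obtain ⟨g, hg⟩ := Module.Projective.exists_dual_ne_zero (R ⧸ 𝔪) hx'
  refine ⟨(((g (𝔪.toCotangent x))⁻¹ • g).restrictScalars R) ∘ₗ 𝔪.toCotangent, ?_⟩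
  exact inv_mul_cancel₀ hg

section

variable {R : Type u} [CommRing R] {𝔪 : Ideal R} [𝔪.IsMaximal] {x : R}

/-- The map `R / 𝔪 → M` sending `1` to `y`, for `y` annihilated by `𝔪`. -/
theorem exists_linearMap_of_quotient {M : Type*} [AddCommGroup M] [Module R M] (𝔪 : Ideal R)
    (y : M) (hy : ∀ a ∈ 𝔪, a • y = 0) : ∃ s : R ⧸ 𝔪 →ₗ[R] M, s 1 = y := by
  refine ⟨Submodule.liftQ 𝔪 (LinearMap.toSpanSingleton R M y) fun a ha => hy a ha, ?_⟩
  exact one_smul R y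

theorem linearMap_quotient_ext {M : Type*} [AddCommGroup M] [Module R M] {𝔪 : Ideal R}
    {f g : R ⧸ 𝔪 →ₗ[R] M} (h : f 1 = g 1) : f = g := by
  apply Submodule.linearMap_qext
  ext
  exact h

theorem IsNPresented.projective_of_isLocalRing {R : Type u} [CommRing R] [IsLocalRing R] {x : R}
    (hx : x ∈ IsLocalRing.maximalIdeal R) (hx2 : x ∉ IsLocalRing.maximalIdeal R ^ 2)
    (hxm : ∀ y ∈ IsLocalRing.maximalIdeal R, y * x = 0) (hfg : ¬ (IsLocalRing.maximalIdeal R).FG)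
    {E : Type*} [AddCommGroup E] [Module R E] (h : IsNPresented R 3 E) :
    Module.Projective R E := by
  have := h.finite
  obtain ⟨n₀, ε₀, hε₀, hm₀⟩ := exists_surjective_ker_le_maximalIdeal (R := R) E
  have h₁ := h.ker ε₀ hε₀
  have := h₁.finite
  obtain ⟨n₁, ε₁, hε₁, hm₁⟩ := exists_surjective_ker_le_maximalIdeal (R := R) (LinearMap.ker ε₀)
  have h₂ := (h₁.ker ε₁ hε₁).finitePresentation
  -- If the minimal cover of the first syzygy has rank `0`, that syzygy vanishes and `E` is free.
  rcases Nat.eq_zero_or_pos n₁ with rfl | hn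
  · have hinj : LinearMap.ker ε₀ = ⊥ := by
      rw [eq_bot_iff]
      intro y hy
      obtain ⟨z, hz⟩ := hε₁ ⟨y, hy⟩
      rw [Subsingleton.elim z 0, map_zero] at hz
      exact (congrArg Subtype.val hz).symm
    exact Module.Projective.of_equiv
      (LinearEquiv.ofBijective ε₀ ⟨LinearMap.ker_eq_bot.1 hinj, hε₀⟩)
  · let i : Fin n₁ := ⟨0, hn⟩
    let 𝔪 := IsLocalRing.maximalIdeal R
    obtain ⟨ψ, hψ⟩ := exists_linearMap_quotient_eq_one (𝔪 := 𝔪) ⟨x, hx⟩ hx2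
    -- By minimality `ker ε₀` has coordinates in `𝔪`, so `x` kills it.
    have hy : ε₁ (x • Pi.single i 1) = 0 := by
      rw [map_smul]
      refine Subtype.ext (funext fun j => ?_)
      exact (mul_comm _ _).trans (hxm _ (hm₀ _ (ε₁ (Pi.single i 1)).2 j))
    obtain ⟨s, hs⟩ := exists_linearMap_of_quotient 𝔪
      (⟨x • Pi.single i 1, hy⟩ : LinearMap.ker ε₁) fun a ha => by
        refine Subtype.ext ?_
        change a • x • (Pi.single i 1 : Fin n₁ → R) = 0
        rw [smul_smul, hxm a ha, zero_smul]
    let φ : LinearMap.ker ε₁ →ₗ[R] R ⧸ 𝔪 :=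
      ψ ∘ₗ (LinearMap.proj i ∘ₗ (LinearMap.ker ε₁).subtype).codRestrict 𝔪 fun v => hm₁ v v.2 i
    have hφs : φ ∘ₗ s = LinearMap.id := linearMap_quotient_ext <| by
      rw [LinearMap.comp_apply, hs, LinearMap.id_apply, ← hψ]
      refine congrArg ψ (Subtype.ext ?_)
      change x * (Pi.single i 1 : Fin n₁ → R) i = x
      rw [Pi.single_eq_same, mul_one]
    have hφ : Function.Surjective φ := fun y => ⟨s y, LinearMap.congr_fun hφs y⟩
    -- `R / 𝔪` is a summand of the finitely presented module `ker ε₁`, and the complement is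
    -- finitely generated.
    have : Module.FinitePresentation R (R ⧸ 𝔪) := by
      refine Module.finitePresentation_of_surjective φ hφ ?_
      rw [LinearMap.ker_eq_range_of_comp_eq_id hφs]
      exact Module.Finite.iff_fg.1 inferInstance
    refine absurd ?_ hfg
    have := Module.FinitePresentation.fg_ker 𝔪.mkQ 𝔪.mkQ_surjective
    rwa [Submodule.ker_mkQ] at this

open CategoryTheory

/-- A retract of a module has at most its projective dimension. -/
theorem hasProjectiveDimensionLE_of_comp_eq_id {M N : Type u} [AddCommGroup M] [AddCommGroup N]
    [Module R M] [Module R N] {n : ℕ} (h : HasProjectiveDimensionLE (ModuleCat.of R N) n)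
    (s : M →ₗ[R] N) (p : N →ₗ[R] M) (hps : p ∘ₗ s = LinearMap.id) :
    HasProjectiveDimensionLE (ModuleCat.of R M) n :=
  Retract.hasProjectiveDimensionLT (Y := ModuleCat.of R N)
    { i := ModuleCat.ofHom s
      r := ModuleCat.ofHom p
      retract := by rw [← ModuleCat.ofHom_comp, hps]; rfl } _

theorem hasProjectiveDimensionLE_ker {M N : Type u} [AddCommGroup M] [AddCommGroup N]
    [Module R M] [Module R N] [Module.Projective R M] {n : ℕ} (p : M →ₗ[R] N)
    (hp : Function.Surjective p) (h : HasProjectiveDimensionLE (ModuleCat.of R N) (n + 1)) :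
    HasProjectiveDimensionLE (ModuleCat.of R (LinearMap.ker p)) n :=
  ((LinearMap.shortExact_shortComplexKer hp).hasProjectiveDimensionLT_X₃_iff n
    ((IsProjective.iff_projective M).1 inferInstance)).1 h

/-- `R / 𝔪` is a summand of its own syzygy `𝔪`, so any bound `d + 1` improves to `d`. At `0`, a
section of `R → R / 𝔪` sends `1` to an element killed by `x` and congruent to `1` modulo `𝔪`, which
forces `x = 0`. -/
theorem not_hasProjectiveDimensionLE_quotient (hx : x ∈ 𝔪) (hx2 : x ∉ 𝔪 ^ 2)
    (hxm : ∀ y ∈ 𝔪, y * x = 0) (d : ℕ) :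
    ¬ HasProjectiveDimensionLE (ModuleCat.of R (R ⧸ 𝔪)) d := by
  induction d with
  | zero =>
    intro h
    have := (hasProjectiveDimensionLE_zero_iff _).1 h
    obtain ⟨s, hs⟩ := Module.projective_lifting_property 𝔪.mkQ LinearMap.id 𝔪.mkQ_surjective
    have hs1 : Ideal.Quotient.mk 𝔪 (s 1) = 1 := LinearMap.congr_fun hs 1
    have hmem : 1 - s 1 ∈ 𝔪 := by
      rw [← Ideal.Quotient.eq_zero_iff_mem, map_sub, hs1, map_one, sub_self]
    have hxs : x * s 1 = 0 := by
      rw [← smul_eq_mul, ← map_smul]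
      have : x • (1 : R ⧸ 𝔪) = 0 := by
        rw [← map_one (Ideal.Quotient.mk 𝔪)]
        exact (Submodule.Quotient.mk_eq_zero 𝔪).2 (by simpa using hx)
      rw [this, map_zero]
    have h0 := hxm _ hmem
    rw [sub_mul, one_mul, mul_comm, hxs, sub_zero] at h0
    exact hx2 (h0 ▸ zero_mem _)
  | succ d ih =>
    intro h
    have h' := hasProjectiveDimensionLE_ker 𝔪.mkQ 𝔪.mkQ_surjective h
    rw [Submodule.ker_mkQ] at h'
    obtain ⟨ψ, hψ⟩ := exists_linearMap_quotient_eq_one (𝔪 := 𝔪) ⟨x, hx⟩ hx2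
    obtain ⟨s, hs⟩ := exists_linearMap_of_quotient 𝔪 (⟨x, hx⟩ : 𝔪) fun a ha =>
      Subtype.ext (hxm a ha)
    refine ih (hasProjectiveDimensionLE_of_comp_eq_id h' s ψ (linearMap_quotient_ext ?_))
    rw [LinearMap.comp_apply, hs, hψ, LinearMap.id_apply]

/-- If the annihilator of `s` is finitely generated, contained in `𝔪` and contains `x`, then
`R / (s)` is a 2-presented module of infinite projective dimension. -/
theorem not_isNDRing_two (hx : x ∈ 𝔪) (hx2 : x ∉ 𝔪 ^ 2) (hxm : ∀ y ∈ 𝔪, y * x = 0) {s : R}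
    (hs : (LinearMap.ker (LinearMap.toSpanSingleton R R s)).FG)
    (hsm : ∀ y, y * s = 0 → y ∈ 𝔪) (hxs : x * s = 0) (d : ℕ) : ¬ IsNDRing R 2 d := by
  intro h
  let e := LinearEquiv.funUnique (Fin 1) R R
  let I : Ideal R := R ∙ s
  have hker : LinearMap.ker I.mkQ = LinearMap.range (LinearMap.toSpanSingleton R R s) := by
    rw [Submodule.ker_mkQ, LinearMap.range_toSpanSingleton]
  let q := (LinearMap.toSpanSingleton R R s).rangeRestrict
  have hq : Function.Surjective q := LinearMap.surjective_rangeRestrict _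
  have hqker : LinearMap.ker q = LinearMap.ker (LinearMap.toSpanSingleton R R s) :=
    LinearMap.ker_rangeRestrict _
  have hE : IsNPresented R 2 (R ⧸ I) := by
    refine IsNPresented.succ_of_surjective e I.mkQ I.mkQ_surjective ?_
    rw [hker]
    refine IsNPresented.succ_of_surjective e q hq ?_
    rw [isNPresented_zero_iff, hqker]
    exact Module.Finite.iff_fg.2 hs
  have h₀ : HasProjectiveDimensionLE (ModuleCat.of R (R ⧸ I)) d :=
    (projectiveDimension_le_iff _ _).1 (h _ hE)
  -- The bound is relaxed by `2` so that the syzygies `(s)` and then the annihilator of `s` can be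
  -- taken for every `d`.
  have h₁ : HasProjectiveDimensionLE (ModuleCat.of R (R ⧸ I)) (d + 2) :=
    hasProjectiveDimensionLT_of_ge _ (d + 1) _ (by omega)
  have h₂ := hasProjectiveDimensionLE_ker (n := d + 1) I.mkQ I.mkQ_surjective h₁
  rw [hker] at h₂
  have h₃ := hasProjectiveDimensionLE_ker q hq h₂
  rw [hqker] at h₃
  obtain ⟨ψ, hψ⟩ := exists_linearMap_quotient_eq_one (𝔪 := 𝔪) ⟨x, hx⟩ hx2
  obtain ⟨t, ht⟩ := exists_linearMap_of_quotient 𝔪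
    (⟨x, hxs⟩ : LinearMap.ker (LinearMap.toSpanSingleton R R s)) fun a ha =>
      Subtype.ext (hxm a ha)
  have hle : LinearMap.ker (LinearMap.toSpanSingleton R R s) ≤ 𝔪 := fun y hy => hsm y hy
  refine not_hasProjectiveDimensionLE_quotient hx hx2 hxm d
    (hasProjectiveDimensionLE_of_comp_eq_id h₃ t (ψ ∘ₗ Submodule.inclusion hle) (linearMap_quotient_ext ?_))
  rw [LinearMap.comp_apply, ht, LinearMap.id_apply, ← hψ]
  rfl

end

/-! ### Modules over a product of two rings. -/

section

open CategoryTheory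

variable {R : Type u} {T : Type v} [CommRing R] [CommRing T]

/-- The `R`-component of a module over `R × T`. -/
def fstComponent (R : Type u) (T : Type v) [CommRing R] [CommRing T] (E : Type*) [AddCommGroup E]
    [Module (R × T) E] : Submodule (R × T) E :=
  LinearMap.ker (LinearMap.lsmul (R × T) E (0, 1))

/-- The `T`-component of a module over `R × T`. -/
def sndComponent (R : Type u) (T : Type v) [CommRing R] [CommRing T] (E : Type*) [AddCommGroup E]
    [Module (R × T) E] : Submodule (R × T) E :=
  LinearMap.range (LinearMap.lsmul (R × T) E (0, 1))

variable (E : Type*) [AddCommGroup E] [Module (R × T) E]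

theorem one_zero_smul_fstComponent (x : fstComponent R T E) : ((1, 0) : R × T) • x = x := by
  have h : ((0, 1) : R × T) • x = 0 := Subtype.ext x.2
  calc ((1, 0) : R × T) • x = ((1, 0) : R × T) • x + ((0, 1) : R × T) • x := by rw [h, add_zero]
    _ = x := by rw [← add_smul]; simp [← Prod.one_eq_mk]

theorem zero_one_smul_sndComponent (x : sndComponent R T E) : ((0, 1) : R × T) • x = x := by
  obtain ⟨_, y, rfl⟩ := x
  refine Subtype.ext ?_
  change ((0, 1) : R × T) • ((0, 1) : R × T) • y = ((0, 1) : R × T) • y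
  rw [smul_smul]
  simp

/-- The map `r ↦ (r, 0)` is not unital; it gives a module structure here because `(1, 0)` acts as
the identity. -/
instance : Module R (fstComponent R T E) where
  smul r x := ((r, 0) : R × T) • x
  one_smul x := one_zero_smul_fstComponent E x
  mul_smul a b x := by
    change ((a * b, 0) : R × T) • x = ((a, 0) : R × T) • ((b, 0) : R × T) • x
    rw [smul_smul]
    simp
  smul_zero a := smul_zero ((a, 0) : R × T)
  smul_add a x y := smul_add ((a, 0) : R × T) x y
  add_smul a b x := by
    change ((a + b, 0) : R × T) • x = ((a, 0) : R × T) • x + ((b, 0) : R × T) • x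
    rw [← add_smul]
    simp
  zero_smul x := zero_smul (R × T) x

instance : Module T (sndComponent R T E) where
  smul r x := ((0, r) : R × T) • x
  one_smul x := zero_one_smul_sndComponent E x
  mul_smul a b x := by
    change ((0, a * b) : R × T) • x = ((0, a) : R × T) • ((0, b) : R × T) • x
    rw [smul_smul]
    simp
  smul_zero a := smul_zero ((0, a) : R × T)
  smul_add a x y := smul_add ((0, a) : R × T) x y
  add_smul a b x := by
    change ((0, a + b) : R × T) • x = ((0, a) : R × T) • x + ((0, b) : R × T) • x
    rw [← add_smul]
    simp
  zero_smul x := zero_smul (R × T) x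

theorem fstComponent_smul_def (r : R) (x : fstComponent R T E) : r • x = ((r, 0) : R × T) • x := rfl

theorem sndComponent_smul_def (t : T) (x : sndComponent R T E) : t • x = ((0, t) : R × T) • x := rfl

theorem fst_smul_fstComponent (s : R × T) (x : fstComponent R T E) : s.1 • x = s • x := by
  rw [fstComponent_smul_def]
  conv_rhs => rw [← one_zero_smul_fstComponent E x, smul_smul]
  simp [Prod.mul_def]

theorem snd_smul_sndComponent (s : R × T) (x : sndComponent R T E) : s.2 • x = s • x := by
  rw [sndComponent_smul_def]
  conv_rhs => rw [← zero_one_smul_sndComponent E x, smul_smul]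
  simp [Prod.mul_def]

/-- `R` as an algebra over `R × T`. -/
abbrev fstAlgebra (R : Type u) (T : Type v) [CommRing R] [CommRing T] : Algebra (R × T) R :=
  (RingHom.fst R T).toAlgebra

/-- `T` as an algebra over `R × T`. -/
abbrev sndAlgebra (R : Type u) (T : Type v) [CommRing R] [CommRing T] : Algebra (R × T) T :=
  (RingHom.snd R T).toAlgebra

attribute [local instance] fstAlgebra sndAlgebra

instance : IsScalarTower (R × T) R (fstComponent R T E) where
  smul_assoc s r x := by
    change (s.1 * r) • x = s • r • x
    rw [mul_smul, fst_smul_fstComponent]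

instance : IsScalarTower (R × T) T (sndComponent R T E) where
  smul_assoc s r x := by
    change (s.2 * r) • x = s • r • x
    rw [mul_smul, snd_smul_sndComponent]

theorem projective_fst : Module.Projective (R × T) R := by
  refine Module.Projective.of_split
    (⟨⟨fun r => (r, 0), fun a b => by simp⟩, fun s a => ?_⟩ : R →ₗ[R × T] R × T)
    (Algebra.linearMap (R × T) R) (LinearMap.ext fun _ => rfl)
  change (s.1 * a, (0 : T)) = (s.1 * a, s.2 * 0)
  rw [mul_zero]

theorem projective_snd : Module.Projective (R × T) T := by
  refine Module.Projective.of_split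
    (⟨⟨fun r => (0, r), fun a b => by simp⟩, fun s a => ?_⟩ : T →ₗ[R × T] R × T)
    (Algebra.linearMap (R × T) T) (LinearMap.ext fun _ => rfl)
  change ((0 : R), s.2 * a) = (s.1 * 0, s.2 * a)
  rw [mul_zero]

theorem algebraMap_fst_surjective : Function.Surjective (algebraMap (R × T) R) :=
  Prod.fst_surjective

theorem algebraMap_snd_surjective : Function.Surjective (algebraMap (R × T) T) :=
  Prod.snd_surjective

/-- The map `E → (1, 0) E`. -/
def toFstComponent : E →ₗ[R × T] fstComponent R T E :=
  (LinearMap.lsmul (R × T) E (1, 0)).codRestrict _ fun x => by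
    change ((0, 1) : R × T) • ((1, 0) : R × T) • x = 0
    rw [smul_smul]
    simp [← Prod.zero_eq_mk]

variable {E}

theorem toFstComponent_coe (x : fstComponent R T E) : toFstComponent E (x : E) = x :=
  Subtype.ext (congrArg Subtype.val (one_zero_smul_fstComponent E x))

/-- Multiplying by the idempotent `(1, 0)` preserves exactness and cuts `(R × T) ^ m` down to `R ^
m`, embedded by `inl`. -/
theorem isNPresented_fstComponent {n : ℕ} (h : IsNPresented (R × T) n E) :
    IsNPresented R n (fstComponent R T E) := by
  obtain ⟨r, ε, δ, hε, h0, h1⟩ := h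
  let inl (m : ℕ) : (Fin m → R) → (Fin m → R × T) := fun v i => (v i, 0)
  have inl_add (m : ℕ) (v w) : inl m (v + w) = inl m v + inl m w := by ext <;> simp [inl]
  have inl_smul (m : ℕ) (c : R) (v) : inl m (c • v) = ((c, 0) : R × T) • inl m v := by
    ext <;> simp [inl]
  have inl_idem (m : ℕ) (v) : ((1, 0) : R × T) • inl m v = inl m v := by ext <;> simp [inl]
  have inl_fst (m : ℕ) (v : Fin m → R × T) : inl m (fun i => (v i).1) = ((1, 0) : R × T) • v := by
    ext <;> simp [inl]
  have fst_inl (m : ℕ) (v : Fin m → R) : (fun i => (inl m v i).1) = v := rfl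
  have inl_zero (m : ℕ) : inl m 0 = 0 := rfl
  have inl_inj (m : ℕ) (v : Fin m → R) : inl m v = 0 ↔ v = 0 :=
    ⟨fun h => by rw [← fst_inl m v, h]; rfl, fun h => by rw [h, inl_zero]⟩
  let ε' : (Fin (r 0) → R) →ₗ[R] fstComponent R T E :=
    { toFun v := toFstComponent E (ε (inl _ v))
      map_add' v w := by rw [inl_add, map_add, map_add]
      map_smul' c v := by rw [inl_smul, map_smul, map_smul]; rfl }
  let δ' (i : ℕ) : (Fin (r (i + 1)) → R) →ₗ[R] (Fin (r i) → R) :=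
    { toFun v j := (δ i (inl _ v) j).1
      map_add' v w := by rw [inl_add, map_add]; rfl
      map_smul' c v := by rw [inl_smul, map_smul]; rfl }
  have hδ' (i : ℕ) (v) : inl _ (δ' i v) = δ i (inl _ v) := by
    change inl _ (fun j => (δ i (inl _ v) j).1) = _
    rw [inl_fst, ← map_smul, inl_idem]
  have hε' (v) : ε' v = 0 ↔ ε (inl _ v) = 0 := by
    rw [Subtype.ext_iff]
    change ((1, 0) : R × T) • ε (inl _ v) = 0 ↔ _
    rw [← map_smul, inl_idem]
  have hδε (i : ℕ) (v : Fin (r i) → R) : inl _ v ∈ Set.range (δ i) ↔ v ∈ Set.range (δ' i) := by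
    constructor
    · rintro ⟨w, hw⟩
      refine ⟨fun j => (w j).1, ?_⟩
      rw [← fst_inl _ (δ' i _), hδ', inl_fst, map_smul, hw, inl_idem]
    · rintro ⟨w, rfl⟩
      exact ⟨_, (hδ' i w).symm⟩
  refine ⟨r, ε', δ', fun x => ?_, fun hn v => ?_, fun i hi v => ?_⟩
  · obtain ⟨v, hv⟩ := hε x
    refine ⟨fun j => (v j).1, ?_⟩
    change toFstComponent E (ε (inl _ _)) = x
    rw [inl_fst, map_smul, map_smul, hv, toFstComponent_coe, one_zero_smul_fstComponent]
  · rw [hε', h0 hn, hδε]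
  · rw [← inl_inj, hδ', h1 i hi, hδε]

instance [Module.Finite (R × T) E] : Module.Finite T (sndComponent R T E) :=
  have : Module.Finite (R × T) (sndComponent R T E) :=
    inferInstanceAs (Module.Finite (R × T) (LinearMap.range (LinearMap.lsmul (R × T) E (0, 1))))
  Module.Finite.of_restrictScalars_finite (R × T) T _

/-- The components are the kernel and range of multiplication by `(0, 1)`, so `E` is an extension of
one by the other; their dimensions may be computed over `R × T`. -/
theorem hasProjectiveDimensionLE_of_components (n : ℕ) (E : Type (max u v)) [AddCommGroup E]
    [Module (R × T) E]
    (h₁ : HasProjectiveDimensionLE (ModuleCat.of R (fstComponent R T E)) n)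
    (h₂ : HasProjectiveDimensionLE (ModuleCat.of T (sndComponent R T E)) n) :
    HasProjectiveDimensionLE (ModuleCat.of (R × T) E) n := by
  have := projective_fst (R := R) (T := T)
  have := projective_snd (R := R) (T := T)
  rw [hasProjectiveDimensionLE_iff_of_algebraMap_surjective.{max u v, u}
    (S := R × T) algebraMap_fst_surjective] at h₁
  rw [hasProjectiveDimensionLE_iff_of_algebraMap_surjective.{max u v, v}
    (S := R × T) algebraMap_snd_surjective] at h₂
  let q := (LinearMap.lsmul (R × T) E (0, 1)).rangeRestrict
  have hq : Function.Surjective q := LinearMap.surjective_rangeRestrict _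
  have hker : LinearMap.ker q = fstComponent R T E := LinearMap.ker_rangeRestrict _
  rw [← hker] at h₁
  exact (LinearMap.shortExact_shortComplexKer hq).hasProjectiveDimensionLT_X₂ (n + 1) h₁ h₂

/-- A finitely generated module over the Noetherian factor `T` of `R × T` is `n`-presented over
`R × T` for every `n`. -/
theorem isNPresented_of_isNoetherianRing_snd [IsNoetherianRing T] (n : ℕ) (X : Type v)
    [AddCommGroup X] [Module T X] [Module (R × T) X] [IsScalarTower (R × T) T X]
    [Module.Finite T X] : IsNPresented (R × T) n X := by
  have := projective_snd (R := R) (T := T)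
  have : Module.Finite (R × T) T :=
    Module.Finite.of_surjective (Algebra.linearMap (R × T) T) algebraMap_snd_surjective
  induction n generalizing X with
  | zero => exact isNPresented_zero_iff.2 (Module.Finite.trans T X)
  | succ n ih =>
    obtain ⟨m, p, hp⟩ := Module.Finite.exists_fin' T X
    have := projective_finsupp (R := R × T) (Fin m) T
    have : Module.Projective (R × T) (Fin m → T) :=
      Module.Projective.of_equiv (Finsupp.linearEquivFunOnFinite (R × T) T (Fin m))
    -- `T ^ m` is projective but in general not free over `R × T`; the kernel is again finite
    -- because `T` is Noetherian.
    exact IsNPresented.succ_of_projective (p.restrictScalars (R × T)) hp (ih (LinearMap.ker p))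

end

/-! ### Arithmetic of the amalgamation. -/

section

variable {A : Type u} {B : Type v} [CommRing A] [CommRing B] (f : A →+* B) (J : Ideal B)

/-- The projection `A ⋈^f J → A`. -/
def amalgamationFst : amalgamation f J →+* A := (RingHom.fst A B).comp (amalgamation f J).subtype

/-- The projection `A ⋈^f J → f(A) + J`. -/
def amalgamationSnd : amalgamation f J →+* rangeAddIdeal f J :=
  ((RingHom.snd A B).comp (amalgamation f J).subtype).codRestrict _ <| by
    rintro ⟨_, a, j, hj, rfl⟩
    exact ⟨a, j, hj, rfl⟩

/-- The element `(a, f a + j)` of `A ⋈^f J`. -/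
def amalgamationMk (a : A) (j : J) : amalgamation f J := ⟨(a, f a + j), a, j, j.2, rfl⟩

theorem amalgamationFst_surjective : Function.Surjective (amalgamationFst f J) :=
  fun a => ⟨amalgamationMk f J a 0, rfl⟩

theorem amalgamationSnd_surjective : Function.Surjective (amalgamationSnd f J) := by
  rintro ⟨_, a, j, hj, rfl⟩
  exact ⟨amalgamationMk f J a ⟨j, hj⟩, rfl⟩

variable {f J}

theorem exists_eq_amalgamationMk (x : amalgamation f J) : ∃ a j, x = amalgamationMk f J a j := by
  obtain ⟨_, a, j, hj, rfl⟩ := x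
  exact ⟨a, ⟨j, hj⟩, rfl⟩

theorem mul_eq_zero_of_sq_eq_bot (hJJ : J ^ 2 = ⊥) {i j : B} (hi : i ∈ J) (hj : j ∈ J) :
    i * j = 0 := by
  have : i * j ∈ J ^ 2 := by
    rw [pow_two]
    exact Ideal.mul_mem_mul hi hj
  rwa [hJJ, Ideal.mem_bot] at this

/-- If `a * b = 1`, then `f b - (f b) ^ 2 * j` inverts `f a + j`: the geometric series stops because
`J ^ 2 = 0`. -/
theorem isLocalHom_amalgamationFst (hJJ : J ^ 2 = ⊥) : IsLocalHom (amalgamationFst f J) := by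
  refine ⟨fun x hx => ?_⟩
  obtain ⟨a, j, rfl⟩ := exists_eq_amalgamationMk x
  obtain ⟨b, hb⟩ := isUnit_iff_exists_inv.1 (show IsUnit a from hx)
  have hfb : f a * f b = 1 := by rw [← map_mul, hb, map_one]
  refine isUnit_iff_exists_inv.2
    ⟨amalgamationMk f J b ⟨-(f b * f b) * j, J.mul_mem_left _ j.2⟩, Subtype.ext (Prod.ext hb ?_)⟩
  change (f a + j) * (f b + -(f b * f b) * j) = 1
  linear_combination (1 - f b * (j : B)) * hfb - f b * f b * mul_eq_zero_of_sq_eq_bot hJJ j.2 j.2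

/-- The kernel `0 × J` of `A ⋈^f J → A` is finitely generated when `J` is finitely generated over
`f(A) + J`. -/
theorem ker_amalgamationFst_fg (h : (idealOfRangeAdd f J).FG) :
    (RingHom.ker (amalgamationFst f J)).FG := by
  obtain ⟨n, g, hg⟩ := Submodule.fg_iff_exists_fin_generating_family.1 h
  have hgJ (i) : (g i : B) ∈ J := by
    have : g i ∈ idealOfRangeAdd f J := hg ▸ Submodule.subset_span ⟨i, rfl⟩
    exact this
  refine Submodule.fg_iff_exists_fin_generating_family.2
    ⟨n, fun i => amalgamationMk f J 0 ⟨g i, hgJ i⟩, le_antisymm ?_ fun x hx => ?_⟩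
  · rw [Submodule.span_le]
    rintro _ ⟨i, rfl⟩
    exact (RingHom.mem_ker).2 rfl
  · have hx1 : amalgamationFst f J x = 0 := hx
    obtain ⟨a, j, rfl⟩ := exists_eq_amalgamationMk x
    obtain rfl : a = 0 := hx1
    have hmem : amalgamationSnd f J (amalgamationMk f J 0 j) ∈ idealOfRangeAdd f J := by
      change f 0 + (j : B) ∈ J
      rw [map_zero, zero_add]
      exact j.2
    rw [← hg] at hmem
    obtain ⟨c, hc⟩ := Ideal.mem_span_range_iff_exists_fun.1 hmem
    choose d hd using fun i => amalgamationSnd_surjective f J (c i)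
    refine Ideal.mem_span_range_iff_exists_fun.2 ⟨d, ?_⟩
    have h₁ : amalgamationFst f J (∑ i, d i * amalgamationMk f J 0 ⟨g i, hgJ i⟩) =
        amalgamationFst f J (amalgamationMk f J 0 j) := by
      rw [map_sum]
      refine Finset.sum_eq_zero fun i _ => ?_
      rw [map_mul]
      exact mul_zero _
    have h₂ : amalgamationSnd f J (∑ i, d i * amalgamationMk f J 0 ⟨g i, hgJ i⟩) =
        amalgamationSnd f J (amalgamationMk f J 0 j) := by
      rw [map_sum, ← hc]
      refine Finset.sum_congr rfl fun i _ => ?_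
      rw [map_mul, hd]
      congr 1
      refine Subtype.ext ?_
      change f 0 + (g i : B) = g i
      rw [map_zero, zero_add]
    exact Subtype.ext (Prod.ext h₁ (congrArg Subtype.val h₂))

variable [IsLocalRing A]

theorem isLocalRing_amalgamation (hJJ : J ^ 2 = ⊥) : IsLocalRing (amalgamation f J) :=
  have := isLocalHom_amalgamationFst (f := f) hJJ
  RingHom.domain_isLocalRing (amalgamationFst f J)

/-- The ideal `M ⋈^f J` of `A ⋈^f J`, for `M` the maximal ideal of `A`. -/
def amalgamationMaximalIdeal (f : A →+* B) (J : Ideal B) : Ideal (amalgamation f J) :=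
  (IsLocalRing.maximalIdeal A).comap (amalgamationFst f J)

instance : (amalgamationMaximalIdeal f J).IsMaximal :=
  Ideal.comap_isMaximal_of_surjective _ (amalgamationFst_surjective f J)

theorem amalgamationMaximalIdeal_not_fg (h : ¬ (IsLocalRing.maximalIdeal A).FG) :
    ¬ (amalgamationMaximalIdeal f J).FG := by
  intro h'
  have := h'.map (amalgamationFst f J)
  rw [amalgamationMaximalIdeal,
    Ideal.map_comap_of_surjective _ (amalgamationFst_surjective f J)] at this
  exact h this

theorem amalgamationMk_zero_mem (j : J) :
    amalgamationMk f J 0 j ∈ amalgamationMaximalIdeal f J :=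
  zero_mem (IsLocalRing.maximalIdeal A)

theorem mul_amalgamationMk_zero
    (hMJ : ∀ m ∈ IsLocalRing.maximalIdeal A, ∀ j ∈ J, f m * j = 0)
    (hJJ : J ^ 2 = ⊥) (j : J) (y) (hy : y ∈ amalgamationMaximalIdeal f J) :
    y * amalgamationMk f J 0 j = 0 := by
  obtain ⟨a, i, rfl⟩ := exists_eq_amalgamationMk y
  refine Subtype.ext (Prod.ext (mul_zero a) ?_)
  change (f a + i) * (f 0 + j) = 0
  rw [map_zero, zero_add, add_mul, hMJ a hy j j.2, mul_eq_zero_of_sq_eq_bot hJJ i.2 j.2, add_zero]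

/-- In a product of two elements of `M ⋈^f J` every term involving `J` vanishes. This keeps `(0, j)`
out of the square. -/
theorem snd_eq_of_mem_sq
    (hMJ : ∀ m ∈ IsLocalRing.maximalIdeal A, ∀ j ∈ J, f m * j = 0)
    (hJJ : J ^ 2 = ⊥) (y) (hy : y ∈ amalgamationMaximalIdeal f J ^ 2) :
    (y : A × B).2 = f (y : A × B).1 := by
  rw [pow_two] at hy
  refine Submodule.mul_induction_on hy ?_ ?_
  · intro x hx y hy
    obtain ⟨a, i, rfl⟩ := exists_eq_amalgamationMk x
    obtain ⟨b, j, rfl⟩ := exists_eq_amalgamationMk y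
    change (f a + i) * (f b + j) = f (a * b)
    rw [map_mul]
    linear_combination hMJ a hx j j.2 + hMJ b hy i i.2 + mul_eq_zero_of_sq_eq_bot hJJ i.2 j.2
  · intro x y hx hy
    change (x : A × B).2 + (y : A × B).2 = f ((x : A × B).1 + (y : A × B).1)
    rw [hx, hy, map_add]

theorem amalgamationMk_zero_notMem_sq
    (hMJ : ∀ m ∈ IsLocalRing.maximalIdeal A, ∀ j ∈ J, f m * j = 0)
    (hJJ : J ^ 2 = ⊥) {j : J} (hj : j ≠ 0) :
    amalgamationMk f J 0 j ∉ amalgamationMaximalIdeal f J ^ 2 := by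
  intro h
  have h' : f 0 + (j : B) = f 0 := snd_eq_of_mem_sq hMJ hJJ _ h
  exact hj (Subtype.ext (add_eq_left.1 h'))

theorem amalgamationMaximalIdeal_eq [IsLocalRing (amalgamation f J)] :
    amalgamationMaximalIdeal f J = IsLocalRing.maximalIdeal (amalgamation f J) :=
  IsLocalRing.eq_maximalIdeal inferInstance

theorem mul_amalgamationMk_eq_zero_iff
    (hMJ : ∀ m ∈ IsLocalRing.maximalIdeal A, ∀ j ∈ J, f m * j = 0)
    {m : A} (hm : m ∈ IsLocalRing.maximalIdeal A)
    (hreg : IsRegular m) (y : amalgamation f J) :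
    y * amalgamationMk f J m 0 = 0 ↔ y ∈ RingHom.ker (amalgamationFst f J) := by
  obtain ⟨a, j, rfl⟩ := exists_eq_amalgamationMk y
  constructor
  · intro h
    have h1 : a * m = 0 := congrArg (amalgamationFst f J) h
    exact hreg.right.mul_right_eq_zero_iff.1 h1
  · intro h
    obtain rfl : a = 0 := h
    refine Subtype.ext (Prod.ext (zero_mul m) ?_)
    change (f 0 + (j : B)) * (f m + 0) = 0
    rw [map_zero, zero_add, add_zero, mul_comm, hMJ m hm j j.2]

end

/-! ### Products with a second factor, and the theorem. -/

section

open CategoryTheory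

/-- `not_isNDRing_two` needs no local ring, so it applies to `𝔪 × T`, `(x, 0)` and `(s, 1)`. The
unit in the second slot makes the annihilator that of `s` times `0`. -/
theorem not_isNDRing_two_prod {R : Type u} {T : Type v} [CommRing R] [CommRing T] {𝔪 : Ideal R}
    [𝔪.IsMaximal] {x : R} (hx : x ∈ 𝔪) (hx2 : x ∉ 𝔪 ^ 2) (hxm : ∀ y ∈ 𝔪, y * x = 0) {s : R}
    (hs : (LinearMap.ker (LinearMap.toSpanSingleton R R s)).FG)
    (hsm : ∀ y, y * s = 0 → y ∈ 𝔪) (hxs : x * s = 0) (d : ℕ) : ¬ IsNDRing (R × T) 2 d := by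
  let 𝔫 : Ideal (R × T) := 𝔪.comap (RingHom.fst R T)
  have : 𝔫.IsMaximal := Ideal.comap_isMaximal_of_surjective _ Prod.fst_surjective
  refine not_isNDRing_two (𝔪 := 𝔫) (x := (x, 0)) (s := (s, 1)) hx (fun h => hx2 ?_)
    (fun y hy => Prod.ext (hxm _ hy) (mul_zero _)) ?_ (fun y hy => hsm _ (congrArg Prod.fst hy))
    (Prod.ext hxs (zero_mul _)) d
  · have h1 := Ideal.mem_map_of_mem (RingHom.fst R T) h
    rw [Ideal.map_pow] at h1
    exact Ideal.pow_right_mono Ideal.map_comap_le 2 h1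
  · obtain ⟨n, g, hg⟩ := Submodule.fg_iff_exists_fin_generating_family.1 hs
    refine Submodule.fg_iff_exists_fin_generating_family.2 ⟨n, fun i => (g i, 0),
      le_antisymm ?_ fun y hy => ?_⟩
    · rw [Submodule.span_le]
      rintro _ ⟨i, rfl⟩
      have : g i * s = 0 := by
        have : g i ∈ LinearMap.ker (LinearMap.toSpanSingleton R R s) :=
          hg ▸ Submodule.subset_span ⟨i, rfl⟩
        exact this
      exact Prod.ext this (zero_mul _)
    · have hy2 : y.2 * 1 = 0 := congrArg Prod.snd hy
      have hy1 : y.1 ∈ LinearMap.ker (LinearMap.toSpanSingleton R R s) := congrArg Prod.fst hy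
      rw [← hg] at hy1
      obtain ⟨c, hc⟩ := Ideal.mem_span_range_iff_exists_fun.1 hy1
      refine Ideal.mem_span_range_iff_exists_fun.2 ⟨fun i => (c i, 0), Prod.ext ?_ ?_⟩
      · rw [Prod.fst_sum, ← hc]
        rfl
      · rw [Prod.snd_sum, ← mul_one y.2, hy2]
        exact Finset.sum_eq_zero fun i _ => zero_mul _

/-- Global dimension is tested in the universe of `T`; finiteness brings `E` there as a quotient of
`T ^ n`. -/
theorem HasGlobalDimension.hasProjectiveDimensionLE {T : Type u} [CommRing T] {d : ℕ}
    (h : HasGlobalDimension T d) (E : Type (max u v)) [AddCommGroup E] [Module T E]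
    [Module.Finite T E] : HasProjectiveDimensionLE (ModuleCat.of T E) d := by
  obtain ⟨n, p, hp⟩ := Module.Finite.exists_fin' T E
  have := (projectiveDimension_le_iff _ _).1 (h.1 ((Fin n → T) ⧸ LinearMap.ker p))
  exact ModuleCat.hasProjectiveDimensionLE_of_linearEquiv.{u, max u v}
    (M := ModuleCat.of T ((Fin n → T) ⧸ LinearMap.ker p)) (N := ModuleCat.of T E)
    (p.quotKerEquivOfSurjective hp) d

variable {R : Type u} {T : Type v} [CommRing R] [CommRing T]

theorem isNDRing_prod [IsLocalRing R] {x : R} (hx : x ∈ IsLocalRing.maximalIdeal R)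
    (hx2 : x ∉ IsLocalRing.maximalIdeal R ^ 2) (hxm : ∀ y ∈ IsLocalRing.maximalIdeal R, y * x = 0)
    (hfg : ¬ (IsLocalRing.maximalIdeal R).FG) {d : ℕ} (h : HasGlobalDimension T d) :
    IsNDRing (R × T) 3 d := by
  intro E _ _ hE
  have := hE.finite
  refine (projectiveDimension_le_iff _ _).2 (hasProjectiveDimensionLE_of_components.{u, v} d E ?_
    (h.hasProjectiveDimensionLE.{v, max u v} _))
  have := (isNPresented_fstComponent hE).projective_of_isLocalRing hx hx2 hxm hfg
  have := (hasProjectiveDimensionLE_zero_iff.{u, max u v} (fstComponent R T E)).2 this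
  exact hasProjectiveDimensionLT_of_ge _ 1 _ (by omega)

attribute [local instance] sndAlgebra

/-- Otherwise all `T / I`, being `n`-presented over `R × T`, have dimension at most `d`, and
Auslander's theorem extends this bound to all `T`-modules. -/
theorem not_isNDRing_prod [IsNoetherianRing T] (n : ℕ) {d : ℕ}
    (h : HasGlobalDimension T (d + 1)) : ¬ IsNDRing (R × T) n d := by
  intro hR
  have : d + 1 ≤ d := h.2 fun E _ _ => (projectiveDimension_le_iff _ _).2 <|
    hasProjectiveDimensionLE_of_forall_quotient d (fun I => ?_) _
  · omega
  let _ : Module (R × T) (T ⧸ I) := Module.compHom _ (RingHom.snd R T)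
  have : IsScalarTower (R × T) T (T ⧸ I) := ⟨fun s t x => mul_smul s.2 t x⟩
  -- `IsNDRing` tests modules in the universe of `R × T`, hence the lift.
  have : IsScalarTower (R × T) T (ULift.{u} (T ⧸ I)) :=
    ⟨fun s t x => congrArg ULift.up (smul_assoc s t x.down)⟩
  have hP := (isNPresented_of_isNoetherianRing_snd (R := R) n (T ⧸ I)).of_equiv
    (ULift.moduleEquiv : ULift.{u} (T ⧸ I) ≃ₗ[R × T] T ⧸ I).symm
  have hpd := (projectiveDimension_le_iff _ _).1 (hR _ hP)
  have := projective_snd (R := R) (T := T)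
  rw [← hasProjectiveDimensionLE_iff_of_algebraMap_surjective.{max u v, v} (T := T)
    algebraMap_snd_surjective] at hpd
  exact ModuleCat.hasProjectiveDimensionLE_of_linearEquiv.{max u v, v}
    (M := ModuleCat.of T (ULift.{u} (T ⧸ I))) (N := ModuleCat.of T (T ⧸ I))
    ULift.moduleEquiv d

end

theorem theorem3p4 {A : Type*} {B : Type*} [CommRing A] [IsLocalRing A] [CommRing B]
    (f : A →+* B) (J : Ideal B) (hJ_ne_top : J ≠ ⊤) (hJ_ne_bot : J ≠ ⊥)
    (hMJ : ∀ m ∈ IsLocalRing.maximalIdeal A, ∀ j ∈ J, f m * j = 0)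
    (hJJ : J ^ 2 = ⊥) :
    (¬ (IsLocalRing.maximalIdeal A).FG → IsNDRing (amalgamation f J) 3 0) ∧
    ((idealOfRangeAdd f J).FG → (∃ m ∈ IsLocalRing.maximalIdeal A, IsRegular m) →
      (∀ d : ℕ, ¬ IsNDRing (amalgamation f J) 2 d) ∧
      (∀ (A₂ : Type*) [CommRing A₂] [IsNoetherianRing A₂] (d : ℕ), HasGlobalDimension A₂ d →
        ¬ (IsLocalRing.maximalIdeal A).FG →
          IsNDRing (amalgamation f J × A₂) 3 d ∧
          ¬ IsNDRing (amalgamation f J × A₂) 2 d ∧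
          (1 ≤ d → ¬ IsNDRing (amalgamation f J × A₂) 3 (d - 1)))) := by
  obtain ⟨j, hj, hj0⟩ := Submodule.exists_mem_ne_zero_of_ne_bot hJ_ne_bot
  have hx := amalgamationMk_zero_mem (f := f) (⟨j, hj⟩ : J)
  have hx2 := amalgamationMk_zero_notMem_sq hMJ hJJ (j := ⟨j, hj⟩) fun h =>
    hj0 (congrArg Subtype.val h)
  have hxm := mul_amalgamationMk_zero hMJ hJJ (⟨j, hj⟩ : J)
  have := isLocalRing_amalgamation (f := f) hJJ
  refine ⟨fun hfg E _ _ hE => ?_, fun hJfg ⟨m, hm, hreg⟩ => ?_⟩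
  · have hfg' := amalgamationMaximalIdeal_not_fg (f := f) (J := J) hfg
    rw [amalgamationMaximalIdeal_eq] at hx hx2 hxm hfg'
    exact (CategoryTheory.projectiveDimension_le_iff _ _).2 <| (hasProjectiveDimensionLE_zero_iff E).2 <|
      hE.projective_of_isLocalRing hx hx2 hxm hfg'
  · have hiff := mul_amalgamationMk_eq_zero_iff hMJ hm hreg
    have hann : (LinearMap.ker (LinearMap.toSpanSingleton (amalgamation f J) (amalgamation f J)
        (amalgamationMk f J m 0))).FG := by
      have heq : LinearMap.ker (LinearMap.toSpanSingleton (amalgamation f J) (amalgamation f J)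
          (amalgamationMk f J m 0)) = RingHom.ker (amalgamationFst f J) := Ideal.ext hiff
      rw [heq]
      exact ker_amalgamationFst_fg hJfg
    have hsm : ∀ y, y * amalgamationMk f J m 0 = 0 → y ∈ amalgamationMaximalIdeal f J := by
      intro y hy
      have : amalgamationFst f J y = 0 := (hiff y).1 hy
      rw [amalgamationMaximalIdeal, Ideal.mem_comap, this]
      exact zero_mem _
    have hxs := (hiff (amalgamationMk f J 0 ⟨j, hj⟩)).2 rfl
    refine ⟨not_isNDRing_two hx hx2 hxm hann hsm hxs, fun A₂ _ _ d hd hfg => ⟨?_,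
      not_isNDRing_two_prod hx hx2 hxm hann hsm hxs d, fun h1 => ?_⟩⟩
    · have hfg' := amalgamationMaximalIdeal_not_fg (f := f) (J := J) hfg
      rw [amalgamationMaximalIdeal_eq] at hx hx2 hxm hfg'
      exact isNDRing_prod hx hx2 hxm hfg' hd
    · obtain ⟨d, rfl⟩ := Nat.exists_eq_add_of_le' h1
      exact not_isNDRing_prod 3 hd
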